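/- Let $m\ge 1$ and $k\geq 3$ be integers with $\lfloor k/2\rfloor+1\le m$. Let $\mathbf{K}_{m,m}$ be the complete bipartite graph with disjoint parts $\mathcal R=\{R_1,\dots,R_m\}$ and $\mathcal C=\{C_1,\dots,C_m\}$, and let $\mathcal P=\mathcal R\times\mathcal C$. Let $K=\mathrm{Sym}(\mathcal R)\times\mathrm{Sym}(\mathcal C)$ act naturally by automorphisms of $\mathbf{K}_{m,m}$, let $\tau$ be the automorphism interchanging $R_i$ and $C_i$ for all $i$, and let $G=\langle K,\tau\rangle$. For a subgraph $\Delta$ of $\mathbf{K}_{m,m}$ let $B(\Delta)$ be the set of all $(R,C)\in\mathcal P$ such that $\{R,C\}$ is an edge of $\Delta$, and define the incidence structures $$\mathcal D(\Delta)=(\mathcal P,\{B(\Delta^g)\mid g\in K\}),\qquad \widehat{\mathcal D}(\Delta)=(\mathcal P,\{B(\Delta^g)\mid g\in G\}).$$ An incidence structure whose blocks are subsets of a finite point set is a $t$-$(v,k,\lambda)$ design ($t,v,k,\lambda$ positive integers) if it has $v$ points, each block has size $k$, and each $t$-element set of points is contained in exactly $\lambda$ blocks; it is a $t$-design if it is a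 $t$-$(v,k,\lambda)$ design for some $v,k,\lambda$. Let $\Delta=P_k$ be the $k$-path in $\mathbf{K}_{m,m}$ with edges $\{R_i,C_i\}$ for $1\le i\le\lceil k/2\rceil$ and $\{R_{i+1},C_i\}$ for $1\le i\le\lfloor k/2\rfloor$. Then $\widehat{\mathcal D}(\Delta)$ is not a $3$-design unless $(k,m)=(3,2)$, and $\widehat{\mathcal D}(\Delta)$ is a $2$-design if and only if $m=k-1$. Moreover, if $m=k-1$, then: (a) if $k$ is odd, then (i) $\widehat{\mathcal D}(\Delta)=\mathcal D(\Delta)$, and hence $\mathcal D(\Delta)$ is a $2$-design, and (ii) $\widehat{\mathcal D}(\Delta)$ is a $2$-$((k-1)^2,k,\lambda)$ design with $$\lambda=\frac{(k-1)!\,(k-3)!}{\left(\left(\frac{k-3}{2}\right)!\right)^2};$$ (b) if $k$ is even, then (i) $\widehat{\mathcal D}(\Delta)\ne\mathcal D(\Delta)$ and $\mathcal D(\Delta)$ is not a $2$-design, and (ii) $\widehat{\mathcal D}(\Delta)$ is a $2$-$((k-1)^2,k,\lambda)$ design with $$\lambda=\frac{(k-1)!\,(k-3)!}{\left(\frac k2-2\right)!\,\left(\frac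 k2-1\right)!}.$$ -/

import Mathlib

/-- A point-block incidence structure on the point set `P`: the blocks are subsets of `P`,
incidence is membership. -/
@[ext]
structure IncidenceStructure (P : Type*) where
  blocks : Set (Set P)

namespace IncidenceStructure

/-- `D` is a `t`-`(v, k, l)` design (`t, v, k, l` positive): there are `v` points, each block has
size `k`, and each `t`-element set of points is contained in exactly `l` blocks. -/
structure IsDesign {P : Type*} [Finite P] (D : IncidenceStructure P) (t v k l : ℕ) : Prop where
  t_pos : 0 < t
  v_pos : 0 < v
  k_pos : 0 < k
  l_pos : 0 < l
  card_points : Nat.card P = v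
  card_block : ∀ B ∈ D.blocks, B.ncard = k
  card_blocks_through : ∀ T : Set P, T.ncard = t → {B | B ∈ D.blocks ∧ T ⊆ B}.ncard = l

/-- `D` is a `t`-design: a `t`-`(v, k, l)` design for some `v, k, l`. -/
def IsTDesign {P : Type*} [Finite P] (D : IncidenceStructure P) (t : ℕ) : Prop :=
  ∃ v k l : ℕ, D.IsDesign t v k l

end IncidenceStructure

namespace GridDesign

/-- The complete bipartite graph `K_{m,n}`; `Sum.inl i` is the vertex `R_{i+1}` and `Sum.inr j`
is the vertex `C_{j+1}`. -/
abbrev Kmn (m n : ℕ) : SimpleGraph (Fin m ⊕ Fin n) := completeBipartiteGraph (Fin m) (Fin n)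

/-- The point set of the grid: the pairs `(R_i, C_j)`. -/
abbrev Point (m n : ℕ) : Type := Fin m × Fin n

/-- The block `B(Δ)`: all points `(R, C)` such that `{R, C}` is an edge of `Δ`. -/
def block {m n : ℕ} (Δ : (Kmn m n).Subgraph) : Set (Point m n) :=
  {p | Δ.Adj (Sum.inl p.1) (Sum.inr p.2)}

/-- The automorphism of `K_{m,n}` given by a permutation of each of the two parts. -/
def partAut (m n : ℕ) :
    Equiv.Perm (Fin m) × Equiv.Perm (Fin n) →* (Kmn m n ≃g Kmn m n) where
  toFun s :=
    { toEquiv := Equiv.sumCongr s.1 s.2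
      map_rel_iff' := by rintro (a | a) (b | b) <;> simp }
  map_one' := by ext (a | a) <;> rfl
  map_mul' s t := by ext (a | a) <;> rfl

/-- `K = Sym(R) × Sym(C)`, as a group of automorphisms of `K_{m,n}`. -/
def groupK (m n : ℕ) : Subgroup (Kmn m n ≃g Kmn m n) := (partAut m n).range

/-- The automorphism `τ` of `K_{m,m}` interchanging `R_i` and `C_i` for all `i`. -/
def tau (m : ℕ) : Kmn m m ≃g Kmn m m where
  toEquiv := Equiv.sumComm (Fin m) (Fin m)
  map_rel_iff' := by rintro (a | a) (b | b) <;> simp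

/-- `G = ⟨K, τ⟩`. -/
def groupG (m : ℕ) : Subgroup (Kmn m m ≃g Kmn m m) :=
  Subgroup.closure ((groupK m m : Set (Kmn m m ≃g Kmn m m)) ∪ {tau m})

/-- `Δ^g`, the image of the subgraph `Δ` under the automorphism `g`. -/
def image {m n : ℕ} (Δ : (Kmn m n).Subgraph) (g : Kmn m n ≃g Kmn m n) : (Kmn m n).Subgraph :=
  Δ.map g.toHom

/-- The incidence structure `D(Δ)`, with blocks `B(Δ^g)` for `g ∈ K`. -/
def design {m n : ℕ} (Δ : (Kmn m n).Subgraph) : IncidenceStructure (Point m n) where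
  blocks := {B | ∃ g ∈ groupK m n, B = block (image Δ g)}

/-- The incidence structure `D̂(Δ)`, with blocks `B(Δ^g)` for `g ∈ G`. -/
def designHat {m : ℕ} (Δ : (Kmn m m).Subgraph) : IncidenceStructure (Point m m) where
  blocks := {B | ∃ g ∈ groupG m, B = block (image Δ g)}

/-- The subgraph of `K_{m,n}` with edges `{R, C}` for `(R, C) ∈ S`, and no isolated vertices. -/
def ofPairs {m n : ℕ} (S : Set (Point m n)) : (Kmn m n).Subgraph where
  verts := {v | ∃ p ∈ S, v = Sum.inl p.1 ∨ v = Sum.inr p.2}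
  Adj u v := ∃ p ∈ S, (u = Sum.inl p.1 ∧ v = Sum.inr p.2) ∨ (u = Sum.inr p.2 ∧ v = Sum.inl p.1)
  adj_sub := by
    rintro u v ⟨p, -, ⟨rfl, rfl⟩ | ⟨rfl, rfl⟩⟩ <;> simp
  edge_vert := by
    rintro u v ⟨p, hp, ⟨rfl, -⟩ | ⟨rfl, -⟩⟩
    · exact ⟨p, hp, Or.inl rfl⟩
    · exact ⟨p, hp, Or.inr rfl⟩
  symm := by
    constructor
    rintro u v ⟨p, hp, h | h⟩
    · exact ⟨p, hp, Or.inr ⟨h.2, h.1⟩⟩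
    · exact ⟨p, hp, Or.inl ⟨h.2, h.1⟩⟩

/-- The `k`-path `P_k` in `K_{m,m}`, with edges `{R_i, C_i}` for `1 ≤ i ≤ ⌈k/2⌉` and
`{R_{i+1}, C_i}` for `1 ≤ i ≤ ⌊k/2⌋` (indices are shifted to start from `0`). It is a path with
`k` edges when it fits into `K_{m,m}`, that is, when `⌊k/2⌋ + 1 ≤ m`. -/
def path (m k : ℕ) : (Kmn m m).Subgraph :=
  ofPairs {p | ((p.1 : ℕ) = p.2 ∧ (p.2 : ℕ) < (k + 1) / 2) ∨
    ((p.1 : ℕ) = p.2 + 1 ∧ (p.2 : ℕ) < k / 2)}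

end GridDesign

open Equiv

namespace GridDesign

/-! ### Blocks as images of a point set -/

/-! Since `τ` normalizes `K` and squares to the identity, `G = K ∪ Kτ`. Hence the blocks of
`D̂(P_k)` are the `K`-orbits of the path and of its transpose (`designHat_blocks`).

Under `G`, ordered pairs of distinct points are of two kinds: collinear (same row or same column)
and skew. `G` is transitive on each kind when it is nonempty, so the number of blocks through a pair
depends only on its kind, and being a 2-design means that the two numbers agree. Both are found by
double counting. The grid has `2m²(m-1)` collinear and `m²(m-1)²` skew ordered pairs. Each block has
`2(k-1)` collinear ones, because exactly the consecutive edges of a path share a vertex, and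
`(k-1)(k-2)` skew ones. The ratios agree iff `m - 1 = k - 2` (`eq_of_isTDesign_two`,
`isDesign_two`), and then `λ = b / (m(m-1))` with `b` the number of blocks.

The value of `b` comes from orbit–stabilizer (`ncard_hatBlocks`). For odd `k` the transpose of the
path lies in its `K`-orbit, and the stabilizer only permutes vertices off the path. For even `k`
reversal doubles the stabilizer, but there are two disjoint orbits, so the formula for `b` is the
same.

For even `k`, a block of `D(P_k)` has fewer row pairs than column pairs, so `D(P_k)` is not a
2-design. Three points of one row lie in no block, because path vertices have degree at most 2; this
excludes 3-designs as soon as `m ≥ 3`. -/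

/-- The permutation of the grid induced by a permutation of the rows and one of the columns. -/
def act {m : ℕ} (g : Perm (Fin m) × Perm (Fin m)) : Perm (Point m m) := Equiv.prodCongr g.1 g.2

@[simp] lemma act_apply {m : ℕ} (g : Perm (Fin m) × Perm (Fin m)) (p : Point m m) :
    act g p = (g.1 p.1, g.2 p.2) := rfl

lemma act_mul_image {m : ℕ} (g h : Perm (Fin m) × Perm (Fin m)) (S : Set (Point m m)) :
    act (g * h) '' S = act g '' (act h '' S) := by
  rw [Set.image_image]; rfl

lemma act_one_image {m : ℕ} (S : Set (Point m m)) : act 1 '' S = S := by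
  have : (act 1 : Point m m → Point m m) = id := rfl
  rw [this, Set.image_id]

lemma swap_image_act {m : ℕ} (g : Perm (Fin m) × Perm (Fin m)) (S : Set (Point m m)) :
    Prod.swap '' (act g '' S) = act g.swap '' (Prod.swap '' S) := by
  rw [Set.image_image, Set.image_image]; rfl

lemma swap_image_swap_image {m : ℕ} (S : Set (Point m m)) :
    Prod.swap '' (Prod.swap '' S) = S := by
  rw [Set.image_image]; simp

/-- The orbit of a point set under row and column permutations. -/
def orbitBlocks {m : ℕ} (S : Set (Point m m)) : Set (Set (Point m m)) :=
  Set.range fun g => act g '' S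

/-- The point set of the path. -/
def pathPoints (m k : ℕ) : Set (Point m m) :=
  {p | ((p.1 : ℕ) = p.2 ∧ (p.2 : ℕ) < (k + 1) / 2) ∨ ((p.1 : ℕ) = p.2 + 1 ∧ (p.2 : ℕ) < k / 2)}

lemma mem_pathPoints {m k : ℕ} {p : Point m m} : p ∈ pathPoints m k ↔
    ((p.1 : ℕ) = p.2 ∧ (p.2 : ℕ) < (k + 1) / 2) ∨ ((p.1 : ℕ) = p.2 + 1 ∧ (p.2 : ℕ) < k / 2) :=
  Iff.rfl

lemma block_image_partAut {m : ℕ} (S : Set (Point m m)) (g : Perm (Fin m) × Perm (Fin m)) :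
    block (image (ofPairs S) (partAut m m g)) = act g '' S := by
  ext p
  constructor
  · rintro ⟨u, v, ⟨q, hq, ⟨rfl, rfl⟩ | ⟨rfl, rfl⟩⟩, h1, h2⟩
    · exact ⟨q, hq, Prod.ext (Sum.inl_injective h1) (Sum.inr_injective h2)⟩
    · exact absurd h1 (by simp [partAut])
  · rintro ⟨q, hq, rfl⟩
    exact ⟨_, _, ⟨q, hq, Or.inl ⟨rfl, rfl⟩⟩, rfl, rfl⟩

lemma block_image_partAut_mul_tau {m : ℕ} (S : Set (Point m m))
    (g : Perm (Fin m) × Perm (Fin m)) :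
    block (image (ofPairs S) (partAut m m g * tau m)) = act g '' (Prod.swap '' S) := by
  ext p
  constructor
  · rintro ⟨u, v, ⟨q, hq, ⟨rfl, rfl⟩ | ⟨rfl, rfl⟩⟩, h1, h2⟩
    · exact absurd h1 (by simp [partAut, tau])
    · exact ⟨q.swap, ⟨q, hq, rfl⟩, Prod.ext (Sum.inl_injective h1) (Sum.inr_injective h2)⟩
  · rintro ⟨_, ⟨q, hq, rfl⟩, rfl⟩
    exact ⟨_, _, ⟨q, hq, Or.inr ⟨rfl, rfl⟩⟩, rfl, rfl⟩

lemma tau_mul_partAut {m : ℕ} (g : Perm (Fin m) × Perm (Fin m)) :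
    tau m * partAut m m g = partAut m m g.swap * tau m := by
  ext (a | a) <;> rfl

lemma tau_mul_tau (m : ℕ) : tau m * tau m = 1 := by
  ext (a | a) <;> rfl

/-- `K ∪ Kτ` is closed under products and inverses: moving `τ` past an element of `K` swaps its two
components, and `τ² = 1`. -/
lemma mem_groupG_iff {m : ℕ} (x : Kmn m m ≃g Kmn m m) :
    x ∈ groupG m ↔ ∃ g, x = partAut m m g ∨ x = partAut m m g * tau m := by
  constructor
  · intro hx
    induction hx using Subgroup.closure_induction with
    | mem x hx =>
      rcases hx with ⟨g, rfl⟩ | rfl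
      · exact ⟨g, Or.inl rfl⟩
      · exact ⟨1, Or.inr (by simp)⟩
    | one => exact ⟨1, Or.inl (by simp)⟩
    | mul x y _ _ hx hy =>
      obtain ⟨g, rfl | rfl⟩ := hx <;> obtain ⟨h, rfl | rfl⟩ := hy
      · exact ⟨g * h, Or.inl (by simp)⟩
      · exact ⟨g * h, Or.inr (by simp [mul_assoc])⟩
      · exact ⟨g * h.swap, Or.inr (by rw [mul_assoc, tau_mul_partAut, map_mul, mul_assoc])⟩
      · exact ⟨g * h.swap, Or.inl (by
          rw [mul_assoc, ← mul_assoc (tau m), tau_mul_partAut, mul_assoc, tau_mul_tau, map_mul,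
            mul_one])⟩
    | inv x _ hx =>
      obtain ⟨g, rfl | rfl⟩ := hx
      · exact ⟨g⁻¹, Or.inl (by simp)⟩
      · refine ⟨g⁻¹.swap, Or.inr ?_⟩
        rw [mul_inv_rev, ← tau_mul_partAut, map_inv, inv_eq_of_mul_eq_one_right (tau_mul_tau m)]
  · rintro ⟨g, rfl | rfl⟩
    · exact Subgroup.subset_closure (Or.inl ⟨g, rfl⟩)
    · exact mul_mem (Subgroup.subset_closure (Or.inl ⟨g, rfl⟩))
        (Subgroup.subset_closure (Or.inr rfl))

lemma design_blocks {m : ℕ} (S : Set (Point m m)) :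
    (design (ofPairs S)).blocks = orbitBlocks S := by
  ext B
  constructor
  · rintro ⟨_, ⟨g, rfl⟩, rfl⟩
    exact ⟨g, (block_image_partAut S g).symm⟩
  · rintro ⟨g, rfl⟩
    exact ⟨_, ⟨g, rfl⟩, (block_image_partAut S g).symm⟩

lemma designHat_blocks {m : ℕ} (S : Set (Point m m)) :
    (designHat (ofPairs S)).blocks = orbitBlocks S ∪ orbitBlocks (Prod.swap '' S) := by
  ext B
  constructor
  · rintro ⟨x, hx, rfl⟩
    obtain ⟨g, rfl | rfl⟩ := (mem_groupG_iff x).1 hx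
    · exact Or.inl ⟨g, (block_image_partAut S g).symm⟩
    · exact Or.inr ⟨g, (block_image_partAut_mul_tau S g).symm⟩
  · rintro (⟨g, rfl⟩ | ⟨g, rfl⟩)
    · exact ⟨_, (mem_groupG_iff _).2 ⟨g, Or.inl rfl⟩, (block_image_partAut S g).symm⟩
    · exact ⟨_, (mem_groupG_iff _).2 ⟨g, Or.inr rfl⟩, (block_image_partAut_mul_tau S g).symm⟩

lemma self_mem_orbitBlocks {m : ℕ} (S : Set (Point m m)) : S ∈ orbitBlocks S :=
  ⟨1, act_one_image S⟩

lemma act_image_mem_orbitBlocks {m : ℕ} {S B : Set (Point m m)}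
    (g : Perm (Fin m) × Perm (Fin m)) (hB : B ∈ orbitBlocks S) :
    act g '' B ∈ orbitBlocks S := by
  obtain ⟨h, rfl⟩ := hB
  exact ⟨g * h, act_mul_image g h S⟩

lemma swap_image_orbitBlocks {m : ℕ} (S : Set (Point m m)) :
    (fun B => Prod.swap '' B) '' orbitBlocks S = orbitBlocks (Prod.swap '' S) := by
  ext B
  constructor
  · rintro ⟨_, ⟨g, rfl⟩, rfl⟩
    exact ⟨g.swap, (swap_image_act g S).symm⟩
  · rintro ⟨g, rfl⟩
    exact ⟨_, ⟨g.swap, rfl⟩, swap_image_act g.swap S⟩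

lemma orbitBlocks_eq_of_mem {m : ℕ} {S T : Set (Point m m)} (h : T ∈ orbitBlocks S) :
    orbitBlocks T = orbitBlocks S := by
  obtain ⟨g, rfl⟩ := h
  ext B
  constructor
  · rintro ⟨h, rfl⟩
    exact act_image_mem_orbitBlocks h ⟨g, rfl⟩
  · rintro ⟨h, rfl⟩
    refine ⟨h * g⁻¹, ?_⟩
    simp only [← act_mul_image, inv_mul_cancel_right]

/-! ### Double counting -/

lemma ncard_mul_eq_ncard_mul {α β : Type*} [Finite α] [Finite β] (r : α → β → Prop)
    {X : Set α} {Y : Set β} {c d : ℕ} (hX : ∀ x ∈ X, {y | y ∈ Y ∧ r x y}.ncard = c)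
    (hY : ∀ y ∈ Y, {x | x ∈ X ∧ r x y}.ncard = d) : X.ncard * c = Y.ncard * d := by
  classical
  have := Fintype.ofFinite α
  have := Fintype.ofFinite β
  rw [Set.ncard_eq_toFinset_card' X, Set.ncard_eq_toFinset_card' Y]
  refine Finset.card_mul_eq_card_mul r (fun x hx => ?_) (fun y hy => ?_)
  · rw [← hX x (by simpa using hx), Set.ncard_eq_toFinset_card']
    congr 1; ext; simp [Finset.bipartiteAbove]
  · rw [← hY y (by simpa using hy), Set.ncard_eq_toFinset_card']
    congr 1; ext; simp [Finset.bipartiteBelow]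

/-- Ordered pairs of distinct points in a row. -/
def rowPairs (m : ℕ) : Set (Point m m × Point m m) := {x | x.1.1 = x.2.1 ∧ x.1.2 ≠ x.2.2}

/-- Ordered pairs of distinct points in a column. -/
def colPairs (m : ℕ) : Set (Point m m × Point m m) := {x | x.1.1 ≠ x.2.1 ∧ x.1.2 = x.2.2}

/-- Ordered pairs of points with distinct rows and distinct columns. -/
def skewPairs (m : ℕ) : Set (Point m m × Point m m) := {x | x.1.1 ≠ x.2.1 ∧ x.1.2 ≠ x.2.2}

/-- The pairs of `X` both of whose entries lie in `B`. -/
def pairsIn {α : Type*} (X : Set (α × α)) (B : Set α) : Set (α × α) :=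
  {x | x ∈ X ∧ x.1 ∈ B ∧ x.2 ∈ B}

lemma ncard_ne_pairs (m : ℕ) : {x : Fin m × Fin m | x.1 ≠ x.2}.ncard = m * (m - 1) := by
  have h : {x : Fin m × Fin m | x.1 ≠ x.2} = ((Finset.univ : Finset (Fin m)).offDiag : Set _) := by
    ext; simp
  rw [h, Set.ncard_coe_finset, Finset.offDiag_card, Finset.card_univ, Fintype.card_fin,
    Nat.mul_sub_one]

lemma ncard_rowPairs (m : ℕ) : (rowPairs m).ncard = m * (m * (m - 1)) := by
  have h : rowPairs m = (fun y : Fin m × (Fin m × Fin m) => ((y.1, y.2.1), (y.1, y.2.2))) ''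
      (Set.univ ×ˢ {x : Fin m × Fin m | x.1 ≠ x.2}) := by
    ext ⟨⟨a, b⟩, c, d⟩
    constructor
    · rintro ⟨h0, h⟩
      obtain rfl : a = c := h0
      exact ⟨(a, b, d), ⟨trivial, h⟩, rfl⟩
    · rintro ⟨⟨a, b, c⟩, ⟨-, h⟩, h'⟩
      simp only [Prod.mk.injEq] at h'
      obtain ⟨⟨rfl, rfl⟩, rfl, rfl⟩ := h'
      exact ⟨rfl, h⟩
  rw [h, Set.ncard_image_of_injective _ (by rintro ⟨a, b, c⟩ ⟨d, e, f⟩ h; simp_all),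
    Set.ncard_prod, ncard_ne_pairs, Set.ncard_univ, Nat.card_fin]

lemma ncard_skewPairs (m : ℕ) : (skewPairs m).ncard = m * (m - 1) * (m * (m - 1)) := by
  have h : skewPairs m = (fun y : (Fin m × Fin m) × (Fin m × Fin m) =>
      ((y.1.1, y.2.1), (y.1.2, y.2.2))) ''
      ({x : Fin m × Fin m | x.1 ≠ x.2} ×ˢ {x : Fin m × Fin m | x.1 ≠ x.2}) := by
    ext ⟨⟨a, b⟩, c, d⟩
    constructor
    · rintro ⟨h, h'⟩
      exact ⟨((a, c), (b, d)), ⟨h, h'⟩, rfl⟩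
    · rintro ⟨⟨⟨a, b⟩, c, d⟩, ⟨h1, h2⟩, h'⟩
      simp only [Prod.mk.injEq] at h'
      obtain ⟨⟨rfl, rfl⟩, rfl, rfl⟩ := h'
      exact ⟨h1, h2⟩
  rw [h, Set.ncard_image_of_injective _ (by rintro ⟨⟨a, b⟩, c, d⟩ ⟨⟨e, f⟩, i, j⟩ h; simp_all),
    Set.ncard_prod, ncard_ne_pairs]

lemma ncard_pairsIn_image {α : Type*} {X Y : Set (α × α)} (e : Perm α)
    (h : ∀ p q, (e p, e q) ∈ Y ↔ (p, q) ∈ X) (B : Set α) :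
    (pairsIn Y (e '' B)).ncard = (pairsIn X B).ncard := by
  rw [← Set.ncard_image_of_injective (pairsIn X B) (Equiv.prodCongr e e).injective]
  congr 1
  ext ⟨p, q⟩
  constructor
  · rintro ⟨h1, ⟨p, hp, rfl⟩, q, hq, rfl⟩
    exact ⟨(p, q), ⟨(h p q).1 h1, hp, hq⟩, rfl⟩
  · rintro ⟨⟨p, q⟩, ⟨h1, hp, hq⟩, h2⟩
    simp only [Equiv.prodCongr_apply, Prod.map_apply, Prod.mk.injEq] at h2
    obtain ⟨rfl, rfl⟩ := h2
    exact ⟨(h p q).2 h1, ⟨p, hp, rfl⟩, ⟨q, hq, rfl⟩⟩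

lemma ncard_rowPairs_act {m : ℕ} (g : Perm (Fin m) × Perm (Fin m)) (B : Set (Point m m)) :
    (pairsIn (rowPairs m) (act g '' B)).ncard = (pairsIn (rowPairs m) B).ncard :=
  ncard_pairsIn_image (act g) (by simp [rowPairs]) B

lemma ncard_colPairs_act {m : ℕ} (g : Perm (Fin m) × Perm (Fin m)) (B : Set (Point m m)) :
    (pairsIn (colPairs m) (act g '' B)).ncard = (pairsIn (colPairs m) B).ncard :=
  ncard_pairsIn_image (act g) (by simp [colPairs]) B

lemma ncard_skewPairs_act {m : ℕ} (g : Perm (Fin m) × Perm (Fin m)) (B : Set (Point m m)) :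
    (pairsIn (skewPairs m) (act g '' B)).ncard = (pairsIn (skewPairs m) B).ncard :=
  ncard_pairsIn_image (act g) (by simp [skewPairs]) B

lemma ncard_rowPairs_swap {m : ℕ} (B : Set (Point m m)) :
    (pairsIn (rowPairs m) (Prod.swap '' B)).ncard = (pairsIn (colPairs m) B).ncard :=
  ncard_pairsIn_image (Equiv.prodComm _ _) (by simp [rowPairs, colPairs, and_comm]) B

lemma ncard_colPairs_swap {m : ℕ} (B : Set (Point m m)) :
    (pairsIn (colPairs m) (Prod.swap '' B)).ncard = (pairsIn (rowPairs m) B).ncard :=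
  ncard_pairsIn_image (Equiv.prodComm _ _) (by simp [rowPairs, colPairs, and_comm]) B

lemma ncard_skewPairs_swap {m : ℕ} (B : Set (Point m m)) :
    (pairsIn (skewPairs m) (Prod.swap '' B)).ncard = (pairsIn (skewPairs m) B).ncard :=
  ncard_pairsIn_image (Equiv.prodComm _ _) (by simp [skewPairs, and_comm]) B

lemma ncard_colPairs (m : ℕ) : (colPairs m).ncard = m * (m * (m - 1)) := by
  have h := ncard_rowPairs_swap (m := m) Set.univ
  rw [Set.image_univ_of_surjective Prod.swap_surjective] at h
  simpa [pairsIn, ncard_rowPairs] using h.symm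

/-! ### Pairs of points of the path -/

lemma ncard_pathPoints {m k : ℕ} (hm : k / 2 + 1 ≤ m) : (pathPoints m k).ncard = k := by
  -- The coordinate sum numbers the edges consecutively along the path, from `0` to `k - 1`.
  have hinj : Set.InjOn (fun p : Point m m => (p.1 : ℕ) + p.2) (pathPoints m k) := by
    rintro ⟨a, b⟩ h ⟨c, d⟩ h' e
    simp only [mem_pathPoints, Prod.mk.injEq, Fin.ext_iff] at *
    omega
  rw [← hinj.ncard_image]
  have : (fun p : Point m m => (p.1 : ℕ) + p.2) '' pathPoints m k = Finset.range k := by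
    ext n
    simp only [Finset.coe_range, Set.mem_Iio]
    constructor
    · rintro ⟨⟨a, b⟩, h, rfl⟩
      simp only [mem_pathPoints] at *
      omega
    · intro hn
      refine ⟨(⟨(n + 1) / 2, by omega⟩, ⟨n / 2, by omega⟩), ?_, ?_⟩ <;>
      simp only [mem_pathPoints] <;> omega
  rw [this, Set.ncard_coe_finset, Finset.card_range]

/-- Exactly the inner row vertices of the path, those with index `1 ≤ r < ⌈k/2⌉`, carry two points,
`(r, r)` and `(r, r-1)`. Each contributes two ordered pairs, numbered here `2r - 1` and `2r - 2`
according to the first entry. -/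
lemma ncard_rowPairs_pathPoints {m k : ℕ} (hm : k / 2 + 1 ≤ m) :
    (pairsIn (rowPairs m) (pathPoints m k)).ncard = 2 * ((k + 1) / 2 - 1) := by
  have hinj : Set.InjOn (fun x : Point m m × Point m m => (x.1.1 : ℕ) + x.1.2 - 1)
      (pairsIn (rowPairs m) (pathPoints m k)) := by
    rintro ⟨⟨a, b⟩, c, d⟩ ⟨⟨h1, h2⟩, h3, h4⟩ ⟨⟨a', b'⟩, c', d'⟩ ⟨⟨h1', h2'⟩, h3', h4'⟩ e
    simp only [mem_pathPoints, Prod.mk.injEq, Fin.ext_iff, ne_eq] at *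
    omega
  rw [← hinj.ncard_image]
  have : (fun x : Point m m × Point m m => (x.1.1 : ℕ) + x.1.2 - 1) ''
      (pairsIn (rowPairs m) (pathPoints m k)) = Finset.range (2 * ((k + 1) / 2 - 1)) := by
    ext n
    simp only [Finset.coe_range, Set.mem_Iio]
    constructor
    · rintro ⟨⟨⟨a, b⟩, c, d⟩, ⟨⟨h1, h2⟩, h3, h4⟩, rfl⟩
      simp only [mem_pathPoints, Fin.ext_iff, ne_eq] at *
      omega
    · intro hn
      refine ⟨((⟨n / 2 + 1, by omega⟩, ⟨n / 2 + n % 2, by omega⟩),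
        (⟨n / 2 + 1, by omega⟩, ⟨n / 2 + 1 - n % 2, by omega⟩)), ⟨⟨rfl, ?_⟩, ?_, ?_⟩, ?_⟩ <;>
      simp only [mem_pathPoints, Fin.ext_iff, ne_eq] <;> omega
  rw [this, Set.ncard_coe_finset, Finset.card_range]

/-- The columns with two points are those of index `c < ⌊k/2⌋`, with points `(c, c)` and `(c+1, c)`;
their ordered pairs are numbered `2c` and `2c + 1`. -/
lemma ncard_colPairs_pathPoints {m k : ℕ} (hm : k / 2 + 1 ≤ m) :
    (pairsIn (colPairs m) (pathPoints m k)).ncard = 2 * (k / 2) := by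
  have hinj : Set.InjOn (fun x : Point m m × Point m m => (x.1.1 : ℕ) + x.1.2)
      (pairsIn (colPairs m) (pathPoints m k)) := by
    rintro ⟨⟨a, b⟩, c, d⟩ ⟨⟨h1, h2⟩, h3, h4⟩ ⟨⟨a', b'⟩, c', d'⟩ ⟨⟨h1', h2'⟩, h3', h4'⟩ e
    simp only [mem_pathPoints, Prod.mk.injEq, Fin.ext_iff, ne_eq] at *
    omega
  rw [← hinj.ncard_image]
  have : (fun x : Point m m × Point m m => (x.1.1 : ℕ) + x.1.2) ''
      (pairsIn (colPairs m) (pathPoints m k)) = Finset.range (2 * (k / 2)) := by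
    ext n
    simp only [Finset.coe_range, Set.mem_Iio]
    constructor
    · rintro ⟨⟨⟨a, b⟩, c, d⟩, ⟨⟨h1, h2⟩, h3, h4⟩, rfl⟩
      simp only [mem_pathPoints, Fin.ext_iff, ne_eq] at *
      omega
    · intro hn
      refine ⟨((⟨n / 2 + n % 2, by omega⟩, ⟨n / 2, by omega⟩),
        (⟨n / 2 + 1 - n % 2, by omega⟩, ⟨n / 2, by omega⟩)), ⟨⟨?_, rfl⟩, ?_, ?_⟩, ?_⟩ <;>
      simp only [mem_pathPoints, Fin.ext_iff, ne_eq] <;> omega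
  rw [this, Set.ncard_coe_finset, Finset.card_range]

/-- The ordered pairs of distinct points of `B`, split by type. -/
lemma ncard_pairsIn_add {m : ℕ} (B : Set (Point m m)) :
    (pairsIn (rowPairs m) B).ncard + (pairsIn (colPairs m) B).ncard +
      (pairsIn (skewPairs m) B).ncard + B.ncard = B.ncard * B.ncard := by
  have h1 : Disjoint (pairsIn (rowPairs m) B) (pairsIn (colPairs m) B) := by
    rw [Set.disjoint_left]
    rintro x ⟨⟨h, -⟩, -⟩ ⟨⟨h', -⟩, -⟩
    exact h' h
  have h2 : Disjoint (pairsIn (rowPairs m) B ∪ pairsIn (colPairs m) B)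
      (pairsIn (skewPairs m) B) := by
    rw [Set.disjoint_left]
    rintro x (⟨⟨h, -⟩, -⟩ | ⟨⟨-, h⟩, -⟩) ⟨⟨h', h''⟩, -⟩
    exacts [h' h, h'' h]
  have h3 : Disjoint (pairsIn (rowPairs m) B ∪ pairsIn (colPairs m) B ∪ pairsIn (skewPairs m) B)
      ((fun p => (p, p)) '' B) := by
    rw [Set.disjoint_left]
    rintro _ ((⟨⟨-, h⟩, -⟩ | ⟨⟨h, -⟩, -⟩) | ⟨⟨h, -⟩, -⟩) ⟨p, -, rfl⟩ <;> exact h rfl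
  rw [← Set.ncard_image_of_injective B (f := fun p => (p, p)) (fun p q h => congrArg Prod.fst h),
    ← Set.ncard_union_eq h1, ← Set.ncard_union_eq h2, ← Set.ncard_union_eq h3,
    Set.ncard_image_of_injective B (f := fun p => (p, p)) (fun p q h => congrArg Prod.fst h),
    ← Set.ncard_prod]
  congr 1
  ext ⟨p, q⟩
  constructor
  · rintro (((⟨-, h⟩ | ⟨-, h⟩) | ⟨-, h⟩) | ⟨p, h, h'⟩)
    · exact h
    · exact h
    · exact h
    · cases h'; exact ⟨h, h⟩
  · rintro h
    by_cases e1 : p.1 = q.1 <;> by_cases e2 : p.2 = q.2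
    · exact Or.inr ⟨p, h.1, Prod.ext rfl (Prod.ext e1 e2)⟩
    · exact Or.inl (Or.inl (Or.inl ⟨⟨e1, e2⟩, h⟩))
    · exact Or.inl (Or.inl (Or.inr ⟨⟨e1, e2⟩, h⟩))
    · exact Or.inl (Or.inr ⟨⟨e1, e2⟩, h⟩)

lemma ncard_skewPairs_pathPoints {m k : ℕ} (hk : 2 ≤ k) (hm : k / 2 + 1 ≤ m) :
    (pairsIn (skewPairs m) (pathPoints m k)).ncard = (k - 1) * (k - 2) := by
  have h := ncard_pairsIn_add (pathPoints m k)
  rw [ncard_rowPairs_pathPoints hm, ncard_colPairs_pathPoints hm, ncard_pathPoints hm] at h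
  obtain ⟨k, rfl⟩ := Nat.exists_eq_add_of_le' hk
  -- Whatever the parity, the collinear pairs are twice the number of pairs of consecutive edges.
  have : 2 * ((k + 2 + 1) / 2 - 1) + 2 * ((k + 2) / 2) = 2 * (k + 1) := by omega
  rw [this] at h
  simp only [Nat.add_sub_cancel, show k + 2 - 1 = k + 1 by omega]
  nlinarith

end GridDesign

namespace GridDesign

/-! ### Stabilizers and the number of blocks -/

/-- The permutations fixing each of the first `n` elements. -/
def fixInit (m n : ℕ) : Set (Perm (Fin m)) := {f | ∀ i : Fin m, (i : ℕ) < n → f i = i}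

lemma ncard_fixInit (m n : ℕ) : (fixInit m n).ncard = (m - n).factorial := by
  have e := Equiv.Perm.subtypeEquivSubtypePerm (fun i : Fin m => n ≤ (i : ℕ))
  have h : fixInit m n = {f | ∀ i : Fin m, ¬ n ≤ (i : ℕ) → f i = i} := by
    simp [fixInit]
  rw [h, ← Nat.card_coe_set_eq]
  refine (Nat.card_congr e).symm.trans ?_
  rw [Nat.card_perm]
  congr 1
  have := Set.InjOn.ncard_image (s := {i : Fin m | n ≤ (i : ℕ)}) (f := fun i : Fin m => (i : ℕ))
    (fun i _ j _ h => Fin.ext h)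
  have h2 : (fun i : Fin m => (i : ℕ)) '' {i : Fin m | n ≤ (i : ℕ)} = Finset.Ico n m := by
    ext i
    simp only [Finset.coe_Ico, Set.mem_Ico]
    constructor
    · rintro ⟨j, hj, rfl⟩
      exact ⟨hj, j.2⟩
    · rintro ⟨h1, h2⟩
      exact ⟨⟨i, h2⟩, h1, rfl⟩
  rw [h2, Set.ncard_coe_finset, Nat.card_Ico] at this
  exact this.symm

/-- The permutation reversing the first `n` elements. -/
def revInit (m n : ℕ) (hn : n ≤ m) : Perm (Fin m) :=
  Function.Involutive.toPerm
    (fun i => ⟨if (i : ℕ) < n then n - 1 - i else i, by have := i.2; split_ifs <;> omega⟩)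
    (fun i => by
      ext
      by_cases h : (i : ℕ) < n
      · have : n - 1 - (i : ℕ) < n := by omega
        simp only [h, this, if_true]; omega
      · simp only [h, if_false])

lemma revInit_val {m n : ℕ} (hn : n ≤ m) (i : Fin m) :
    (revInit m n hn i : ℕ) = if (i : ℕ) < n then n - 1 - i else i := rfl

lemma revInit_revInit {m n : ℕ} (hn : n ≤ m) (i : Fin m) :
    revInit m n hn (revInit m n hn i) = i :=
  Function.Involutive.toPerm_involutive _ i

/-- The elements of `Sym(R) × Sym(C)` stabilizing `S`. -/
def stab {m : ℕ} (S : Set (Point m m)) : Set (Perm (Fin m) × Perm (Fin m)) :=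
  {g | act g '' S = S}

lemma mem_stab_iff {m : ℕ} {S : Set (Point m m)} {g : Perm (Fin m) × Perm (Fin m)} :
    g ∈ stab S ↔ ∀ p, act g p ∈ S ↔ p ∈ S := by
  constructor
  · intro h p
    conv_lhs => rw [← (h : act g '' S = S)]
    exact (act g).injective.mem_set_image
  · intro h
    show act g '' S = S
    ext p
    constructor
    · rintro ⟨q, hq, rfl⟩
      exact (h q).2 hq
    · intro hp
      refine ⟨(act g).symm p, (h _).1 ?_, ?_⟩ <;> simp [hp]

lemma mul_mem_stab {m : ℕ} {S : Set (Point m m)} {g h : Perm (Fin m) × Perm (Fin m)}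
    (hg : g ∈ stab S) (hh : h ∈ stab S) : g * h ∈ stab S := by
  show act (g * h) '' S = S
  rw [act_mul_image, (hh : act h '' S = S), (hg : act g '' S = S)]

lemma ncard_orbitBlocks_mul {m : ℕ} (S : Set (Point m m)) :
    (orbitBlocks S).ncard * (stab S).ncard = m.factorial * m.factorial := by
  have h := ncard_mul_eq_ncard_mul (α := Perm (Fin m) × Perm (Fin m)) (β := Set (Point m m))
    (fun g B => act g '' S = B) (X := Set.univ) (Y := orbitBlocks S) (c := 1) (d := (stab S).ncard)
    (fun g _ => by
      rw [Set.ncard_eq_one]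
      refine ⟨act g '' S, ?_⟩
      ext B
      constructor
      · rintro ⟨-, h⟩
        exact h.symm
      · rintro rfl
        exact ⟨⟨g, rfl⟩, rfl⟩)
    (by
      rintro _ ⟨h, rfl⟩
      rw [← Set.ncard_image_of_injective (stab S) (mul_right_injective h)]
      congr 1
      ext g
      constructor
      · rintro ⟨-, hg⟩
        refine ⟨h⁻¹ * g, ?_, mul_inv_cancel_left h g⟩
        show act (h⁻¹ * g) '' S = S
        rw [act_mul_image, hg]
        simp only [← act_mul_image, inv_mul_cancel, act_one_image]
      · rintro ⟨g, hg, rfl⟩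
        refine ⟨trivial, ?_⟩
        rw [act_mul_image, (hg : act g '' S = S)])
  rw [← h, Set.ncard_univ, mul_one, Nat.card_prod, Nat.card_perm, Nat.card_fin]

lemma fixInit_subset_stab {m k : ℕ} :
    fixInit m (k / 2 + 1) ×ˢ fixInit m ((k + 1) / 2) ⊆ stab (pathPoints m k) := by
  rintro ⟨s, t⟩ ⟨hs, ht⟩
  show act (s, t) '' _ = _
  have key : ∀ p ∈ pathPoints m k, act (s, t) p = p := by
    rintro ⟨i, j⟩ h
    simp only [mem_pathPoints] at h
    exact Prod.ext (hs i (by show (i : ℕ) < _; omega)) (ht j (by show (j : ℕ) < _; omega))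
  rw [Set.image_congr key, Set.image_id']

/-- Walk along the path from its fixed first vertex. The image of each next vertex is a path
neighbour of the vertex just shown to be fixed, and injectivity excludes the previous one, so it is
forced. -/
lemma mem_fixInit_of_mem_stab {m k : ℕ} (hk : 2 ≤ k) (hm : k / 2 + 1 ≤ m)
    {g : Perm (Fin m) × Perm (Fin m)} (hg : g ∈ stab (pathPoints m k))
    (h0 : (g.1 ⟨0, by omega⟩ : ℕ) = 0) :
    g ∈ fixInit m (k / 2 + 1) ×ˢ fixInit m ((k + 1) / 2) := by
  rw [mem_stab_iff] at hg
  have key : ∀ n : ℕ, (∀ hn : n < k / 2 + 1, g.1 ⟨n, by omega⟩ = ⟨n, by omega⟩) ∧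
      (∀ hn : n < (k + 1) / 2, g.2 ⟨n, by omega⟩ = ⟨n, by omega⟩) := by
    intro n
    induction n with
    | zero =>
      have h1 := (hg (⟨0, by omega⟩, ⟨0, by omega⟩)).2 (Or.inl ⟨rfl, by show 0 < _; omega⟩)
      simp only [mem_pathPoints, act_apply] at h1
      refine ⟨fun _ => Fin.ext h0, fun _ => Fin.ext ?_⟩
      show _ = 0
      omega
    | succ n ih =>
      have hrow : ∀ hn : n + 1 < k / 2 + 1, g.1 ⟨n + 1, by omega⟩ = ⟨n + 1, by omega⟩ := by
        intro hn
        have h1 := (hg (⟨n + 1, by omega⟩, ⟨n, by omega⟩)).2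
          (Or.inr ⟨rfl, by show n < _; omega⟩)
        simp only [mem_pathPoints, act_apply, ih.2 (by omega)] at h1
        have h2 : (g.1 ⟨n + 1, by omega⟩ : ℕ) ≠ n := by
          intro h
          have := g.1.injective ((Fin.ext h : _ = (⟨n, by omega⟩ : Fin m)).trans
            (ih.1 (by omega)).symm)
          simp at this
        ext
        show _ = n + 1
        omega
      refine ⟨hrow, fun hn => ?_⟩
      have h1 := (hg (⟨n + 1, by omega⟩, ⟨n + 1, by omega⟩)).2
        (Or.inl ⟨rfl, by show n + 1 < _; omega⟩)
      simp only [mem_pathPoints, act_apply, hrow (by omega)] at h1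
      have h2 : (g.2 ⟨n + 1, by omega⟩ : ℕ) ≠ n := by
        intro h
        have := g.2.injective ((Fin.ext h : _ = (⟨n, by omega⟩ : Fin m)).trans
          (ih.2 (by omega)).symm)
        simp at this
      ext
      show _ = n + 1
      omega
  exact ⟨fun i hi => (key i).1 hi, fun i hi => (key i).2 hi⟩

/-- An element stabilizing the path maps its first row to a row with exactly one point. -/
lemma stab_row_zero {m k : ℕ} (hk : 2 ≤ k) (hm : k / 2 + 1 ≤ m)
    {g : Perm (Fin m) × Perm (Fin m)} (hg : g ∈ stab (pathPoints m k)) :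
    (g.1 ⟨0, by omega⟩ : ℕ) = 0 ∨ Even k ∧ (g.1 ⟨0, by omega⟩ : ℕ) = k / 2 := by
  rw [mem_stab_iff] at hg
  set r := g.1 ⟨0, by omega⟩ with hr
  have hcol : ∀ c, (r, c) ∈ pathPoints m k → (g.2.symm c : ℕ) = 0 := by
    intro c hc
    have h1 := (hg (⟨0, by omega⟩, g.2.symm c)).1 (by simpa [← hr] using hc)
    simp only [mem_pathPoints] at h1
    omega
  by_contra hcon
  have h1 := (hg (⟨0, by omega⟩, ⟨0, by omega⟩)).2 (Or.inl ⟨rfl, by show 0 < _; omega⟩)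
  simp only [mem_pathPoints, act_apply, ← hr] at h1
  have hpos : (r : ℕ) ≠ 0 := by tauto
  have hlt : (r : ℕ) < (k + 1) / 2 := by
    rcases Nat.even_or_odd k with h | h
    · have : (r : ℕ) ≠ k / 2 := by tauto
      omega
    · obtain ⟨l, rfl⟩ := h
      omega
  -- Row `r` would be an inner vertex, with points in columns `r` and `r - 1`; both columns would
  -- then come from the single column meeting row `0`.
  have e1 := hcol r (Or.inl ⟨rfl, hlt⟩)
  have e2 := hcol ⟨r - 1, by omega⟩ (Or.inr ⟨by show (r : ℕ) = r - 1 + 1; omega,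
    by show (r : ℕ) - 1 < _; omega⟩)
  have := g.2.symm.injective (Fin.ext (e1.trans e2.symm))
  rw [Fin.ext_iff] at this
  simp only at this
  omega

/-- For even `k` both ends of the path are row vertices, so traversing it backwards preserves the
two parts. -/
lemma rev_mem_stab {m k : ℕ} (hk : Even k) (hm : k / 2 + 1 ≤ m) :
    (revInit m (k / 2 + 1) hm, revInit m (k / 2) (by omega)) ∈ stab (pathPoints m k) := by
  obtain ⟨l, rfl⟩ := hk
  rw [mem_stab_iff]
  rintro ⟨i, j⟩
  simp only [mem_pathPoints, act_apply, revInit_val]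
  split_ifs <;> omega

lemma ncard_stab_odd {m k : ℕ} (hk : 2 ≤ k) (ho : Odd k) (hm : k / 2 + 1 ≤ m) :
    (stab (pathPoints m k)).ncard = (m - (k / 2 + 1)).factorial * (m - (k + 1) / 2).factorial := by
  rw [← ncard_fixInit, ← ncard_fixInit, ← Set.ncard_prod]
  congr 1
  refine Set.Subset.antisymm (fun g hg => ?_) fixInit_subset_stab
  rcases stab_row_zero hk hm hg with h | h
  · exact mem_fixInit_of_mem_stab hk hm hg h
  · exact absurd h.1 (Nat.not_even_iff_odd.2 ho)

lemma ncard_stab_even {m k : ℕ} (hk : 2 ≤ k) (he : Even k) (hm : k / 2 + 1 ≤ m) :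
    (stab (pathPoints m k)).ncard =
      2 * ((m - (k / 2 + 1)).factorial * (m - (k + 1) / 2).factorial) := by
  set F := fixInit m (k / 2 + 1) ×ˢ fixInit m ((k + 1) / 2) with hF
  set r : Perm (Fin m) × Perm (Fin m) :=
    (revInit m (k / 2 + 1) hm, revInit m (k / 2) (by omega)) with hr
  have hrr : r * r = 1 := by
    refine Prod.ext (Equiv.ext fun i => ?_) (Equiv.ext fun i => ?_) <;>
    exact revInit_revInit (by omega) i
  -- Either the first row is fixed, or it goes to the other end of the path and composing with the
  -- reversal fixes it.
  have hst : stab (pathPoints m k) = F ∪ (fun g => r * g) '' F := by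
    refine Set.Subset.antisymm (fun g hg => ?_) (Set.union_subset fixInit_subset_stab ?_)
    · rcases stab_row_zero hk hm hg with h | h
      · exact Or.inl (mem_fixInit_of_mem_stab hk hm hg h)
      · refine Or.inr ⟨r * g, mem_fixInit_of_mem_stab hk hm (mul_mem_stab (rev_mem_stab he hm) hg) ?_,
          by simp only [← mul_assoc, hrr, one_mul]⟩
        show (revInit m (k / 2 + 1) hm (g.1 _) : ℕ) = 0
        rw [revInit_val, h.2]
        simp
    · rintro _ ⟨g, hg, rfl⟩
      exact mul_mem_stab (rev_mem_stab he hm) (fixInit_subset_stab hg)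
  -- Elements of `F` fix row `0`, whereas those of `rF` send it to row `k / 2`.
  have hdisj : Disjoint F ((fun g => r * g) '' F) := by
    rw [Set.disjoint_left]
    rintro _ hg ⟨g, hg', rfl⟩
    have h1 : revInit m (k / 2 + 1) hm (g.1 ⟨0, by omega⟩) = _ :=
      hg.1 ⟨0, by omega⟩ (Nat.succ_pos _)
    rw [hg'.1 ⟨0, by omega⟩ (Nat.succ_pos _), Fin.ext_iff, revInit_val] at h1
    simp at h1
    omega
  rw [hst, Set.ncard_union_eq hdisj, Set.ncard_image_of_injective F (mul_right_injective r), hF,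
    Set.ncard_prod, ncard_fixInit, ncard_fixInit, two_mul]

/-- For odd `k` one end is a row and the other a column. Reversal therefore interchanges the parts,
and reversing both index ranges sends `(j+1, j)` to a point just above the diagonal. -/
lemma swap_pathPoints_mem {m k : ℕ} (ho : Odd k) (hm : k / 2 + 1 ≤ m) :
    Prod.swap '' pathPoints m k ∈ orbitBlocks (pathPoints m k) := by
  refine ⟨(revInit m (k / 2 + 1) hm, revInit m (k / 2 + 1) hm), ?_⟩
  obtain ⟨l, rfl⟩ := ho
  ext ⟨i, j⟩
  constructor
  · rintro ⟨⟨i, j⟩, h, h'⟩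
    rw [← h']
    refine ⟨_, ?_, Prod.swap_swap _⟩
    simp only [mem_pathPoints, act_apply, revInit_val, Prod.fst_swap, Prod.snd_swap] at *
    split_ifs <;> omega
  · rintro ⟨⟨i, j⟩, h, h'⟩
    rw [← h']
    refine ⟨act (revInit m ((2 * l + 1) / 2 + 1) hm, revInit m ((2 * l + 1) / 2 + 1) hm) (j, i),
      ?_, ?_⟩
    · simp only [mem_pathPoints, act_apply, revInit_val] at *
      split_ifs <;> omega
    · simp [revInit_revInit]

/-- The number of row pairs is a `K`-invariant, equal to `k - 2` on one orbit and `k` on the other.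
-/
lemma disjoint_orbitBlocks_swap {m k : ℕ} (he : Even k) (hk : 2 ≤ k) (hm : k / 2 + 1 ≤ m) :
    Disjoint (orbitBlocks (pathPoints m k)) (orbitBlocks (Prod.swap '' pathPoints m k)) := by
  rw [Set.disjoint_left]
  rintro _ ⟨g, rfl⟩ ⟨h, e⟩
  have := congrArg (fun B => (pairsIn (rowPairs m) B).ncard) e
  simp only [ncard_rowPairs_act, ncard_rowPairs_swap, ncard_colPairs_pathPoints hm,
    ncard_rowPairs_pathPoints hm] at this
  obtain ⟨l, rfl⟩ := he
  omega

lemma ncard_orbitBlocks_swap {m : ℕ} (S : Set (Point m m)) :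
    (orbitBlocks (Prod.swap '' S)).ncard = (orbitBlocks S).ncard := by
  rw [← swap_image_orbitBlocks]
  exact Set.ncard_image_of_injective _ (Set.image_injective.2 Prod.swap_injective)

/-- The blocks of `D̂(P_k)`. -/
def hatBlocks (m k : ℕ) : Set (Set (Point m m)) :=
  orbitBlocks (pathPoints m k) ∪ orbitBlocks (Prod.swap '' pathPoints m k)

lemma hatBlocks_odd {m k : ℕ} (ho : Odd k) (hm : k / 2 + 1 ≤ m) :
    hatBlocks m k = orbitBlocks (pathPoints m k) := by
  rw [hatBlocks, orbitBlocks_eq_of_mem (swap_pathPoints_mem ho hm), Set.union_self]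

/-- For even `k` the second orbit compensates for the factor 2 in the stabilizer. -/
lemma ncard_hatBlocks {m k : ℕ} (hk : 2 ≤ k) (hm : k / 2 + 1 ≤ m) :
    (hatBlocks m k).ncard * ((m - (k / 2 + 1)).factorial * (m - (k + 1) / 2).factorial) =
      m.factorial * m.factorial := by
  have h := ncard_orbitBlocks_mul (pathPoints m k)
  rcases Nat.even_or_odd k with he | ho
  · rw [hatBlocks, Set.ncard_union_eq (disjoint_orbitBlocks_swap he hk hm),
      ncard_orbitBlocks_swap, ← h, ncard_stab_even hk he hm]
    ring
  · rw [hatBlocks_odd ho hm, ← h, ncard_stab_odd hk ho hm]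

/-! ### Blocks through a pair of points -/

/-- The blocks through both entries of a pair. -/
def blocksThrough {α : Type*} (D : Set (Set α)) (x : α × α) : Set (Set α) :=
  {B | B ∈ D ∧ x.1 ∈ B ∧ x.2 ∈ B}

lemma ncard_mul_blocksThrough {m : ℕ} {D : Set (Set (Point m m))} {X : Set (Point m m × Point m m)}
    {c d : ℕ} (hX : ∀ x ∈ X, (blocksThrough D x).ncard = c)
    (hD : ∀ B ∈ D, (pairsIn X B).ncard = d) : X.ncard * c = D.ncard * d :=
  ncard_mul_eq_ncard_mul (fun (x : Point m m × Point m m) B => x.1 ∈ B ∧ x.2 ∈ B) hX hD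

lemma ncard_blocksThrough_map {α : Type*} {D : Set (Set α)} (e : Perm α)
    (hD : ∀ B, e '' B ∈ D ↔ B ∈ D) (p q : α) :
    (blocksThrough D (e p, e q)).ncard = (blocksThrough D (p, q)).ncard := by
  rw [← Set.ncard_image_of_injective (blocksThrough D (p, q)) (Set.image_injective.2 e.injective)]
  congr 1
  ext B
  constructor
  · rintro ⟨h, hp, hq⟩
    have hB : e '' (e.symm '' B) = B := by simp
    refine ⟨e.symm '' B, ⟨(hD _).1 (by rwa [hB]), ⟨_, hp, by simp⟩, ⟨_, hq, by simp⟩⟩, hB⟩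
  · rintro ⟨B, ⟨h, hp, hq⟩, rfl⟩
    exact ⟨(hD _).2 h, ⟨p, hp, rfl⟩, ⟨q, hq, rfl⟩⟩

lemma act_image_mem_orbitBlocks_iff {m : ℕ} {S B : Set (Point m m)}
    (g : Perm (Fin m) × Perm (Fin m)) : act g '' B ∈ orbitBlocks S ↔ B ∈ orbitBlocks S := by
  refine ⟨fun h => ?_, act_image_mem_orbitBlocks g⟩
  have := act_image_mem_orbitBlocks g⁻¹ h
  rwa [← act_mul_image, inv_mul_cancel, act_one_image] at this

lemma swap_image_mem_orbitBlocks_iff {m : ℕ} {S B : Set (Point m m)} :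
    Prod.swap '' B ∈ orbitBlocks (Prod.swap '' S) ↔ B ∈ orbitBlocks S := by
  rw [← swap_image_orbitBlocks]
  exact (Set.image_injective.2 Prod.swap_injective).mem_set_image

lemma act_image_mem_hatBlocks_iff {m k : ℕ} {B : Set (Point m m)}
    (g : Perm (Fin m) × Perm (Fin m)) : act g '' B ∈ hatBlocks m k ↔ B ∈ hatBlocks m k :=
  or_congr (act_image_mem_orbitBlocks_iff g) (act_image_mem_orbitBlocks_iff g)

lemma swap_image_mem_hatBlocks_iff {m k : ℕ} {B : Set (Point m m)} :
    Prod.swap '' B ∈ hatBlocks m k ↔ B ∈ hatBlocks m k := by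
  have h1 := swap_image_mem_orbitBlocks_iff (S := pathPoints m k) (B := B)
  have h2 := swap_image_mem_orbitBlocks_iff (S := Prod.swap '' pathPoints m k) (B := B)
  rw [swap_image_swap_image] at h2
  simp only [hatBlocks, Set.mem_union, h1, h2, or_comm]

lemma exists_perm_pair {m : ℕ} {a b c d : Fin m} (hab : a ≠ b) (hcd : c ≠ d) :
    ∃ s : Perm (Fin m), s a = c ∧ s b = d := by
  refine ⟨Equiv.swap a c * Equiv.swap b (Equiv.swap a c d), ?_, ?_⟩
  · have : a ≠ Equiv.swap a c d := by
      intro h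
      have := congrArg (Equiv.swap a c) h
      simp at this
      exact hcd this
    rw [Perm.mul_apply, Equiv.swap_apply_of_ne_of_ne hab this, Equiv.swap_apply_left]
  · simp

/-- `K` is transitive on row pairs because `Sym(C)` is 2-transitive; transposition, a symmetry of
`hatBlocks`, turns column pairs into row pairs. -/
lemma exists_ncard_blocksThrough_line (m k : ℕ) :
    ∃ c, ∀ x ∈ rowPairs m ∪ colPairs m, (blocksThrough (hatBlocks m k) x).ncard = c := by
  have hrow : ∀ x ∈ rowPairs m, ∀ y ∈ rowPairs m,
      (blocksThrough (hatBlocks m k) x).ncard = (blocksThrough (hatBlocks m k) y).ncard := by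
    rintro ⟨⟨a, b⟩, c, d⟩ ⟨h1, h2⟩ ⟨⟨a', b'⟩, c', d'⟩ ⟨h1', h2'⟩
    obtain rfl : a = c := h1
    obtain rfl : a' = c' := h1'
    obtain ⟨s, rfl, rfl⟩ := exists_perm_pair h2 h2'
    have := ncard_blocksThrough_map (act (Equiv.swap a a', s))
      (fun B => act_image_mem_hatBlocks_iff (k := k) _) (a, b) (a, d)
    simp at this
    exact this.symm
  have hall : ∀ x ∈ rowPairs m ∪ colPairs m, ∀ y ∈ rowPairs m,
      (blocksThrough (hatBlocks m k) x).ncard = (blocksThrough (hatBlocks m k) y).ncard := by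
    rintro x (hx | ⟨h1, h2⟩) y hy
    · exact hrow x hx y hy
    · have := ncard_blocksThrough_map (Equiv.prodComm _ _)
        (fun B => swap_image_mem_hatBlocks_iff (m := m) (k := k)) x.1 x.2
      rw [← hrow ((Equiv.prodComm _ _) x.1, (Equiv.prodComm _ _) x.2) ⟨h2, h1⟩ y hy]
      exact this.symm
  -- If there are no row pairs there are no column pairs either, and any constant serves.
  rcases (rowPairs m).eq_empty_or_nonempty with h | ⟨y, hy⟩
  · have hc : (colPairs m) = ∅ := by
      rw [← Set.ncard_eq_zero, ncard_colPairs, ← ncard_rowPairs, h, Set.ncard_empty]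
    exact ⟨0, by simp [h, hc]⟩
  · exact ⟨_, fun x hx => hall x hx y hy⟩

lemma exists_ncard_blocksThrough_skew (m k : ℕ) :
    ∃ c, ∀ x ∈ skewPairs m, (blocksThrough (hatBlocks m k) x).ncard = c := by
  rcases (skewPairs m).eq_empty_or_nonempty with h | ⟨⟨⟨a, b⟩, c, d⟩, h1, h2⟩
  · exact ⟨0, by simp [h]⟩
  · refine ⟨(blocksThrough (hatBlocks m k) ((a, b), (c, d))).ncard, ?_⟩
    rintro ⟨⟨a', b'⟩, c', d'⟩ ⟨h1', h2'⟩
    obtain ⟨s, rfl, rfl⟩ := exists_perm_pair h1 h1'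
    obtain ⟨t, rfl, rfl⟩ := exists_perm_pair h2 h2'
    exact ncard_blocksThrough_map (act (s, t))
      (fun B => act_image_mem_hatBlocks_iff (k := k) _) (a, b) (c, d)

lemma disjoint_rowPairs_colPairs (m : ℕ) : Disjoint (rowPairs m) (colPairs m) := by
  rw [Set.disjoint_left]
  rintro x ⟨h, -⟩ ⟨h', -⟩
  exact h' h

lemma ncard_linePairs (m : ℕ) :
    (rowPairs m ∪ colPairs m).ncard = 2 * (m * (m * (m - 1))) := by
  rw [Set.ncard_union_eq (disjoint_rowPairs_colPairs m), ncard_rowPairs, ncard_colPairs, two_mul]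

lemma pairsIn_union {α : Type*} (X Y : Set (α × α)) (B : Set α) :
    pairsIn (X ∪ Y) B = pairsIn X B ∪ pairsIn Y B := by
  ext x
  simp only [pairsIn, Set.mem_union, Set.mem_ofPred_eq]
  tauto

lemma ncard_linePairs_in {m k : ℕ} (hk : 2 ≤ k) (hm : k / 2 + 1 ≤ m) {B : Set (Point m m)}
    (hB : B ∈ hatBlocks m k) : (pairsIn (rowPairs m ∪ colPairs m) B).ncard = 2 * (k - 1) := by
  have hd : Disjoint (pairsIn (rowPairs m) B) (pairsIn (colPairs m) B) :=
    (disjoint_rowPairs_colPairs m).mono (fun x hx => hx.1) (fun x hx => hx.1)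
  rw [pairsIn_union, Set.ncard_union_eq hd]
  rcases hB with ⟨g, rfl⟩ | ⟨g, rfl⟩ <;>
  simp only [ncard_rowPairs_act, ncard_colPairs_act, ncard_rowPairs_swap, ncard_colPairs_swap,
    ncard_rowPairs_pathPoints hm, ncard_colPairs_pathPoints hm] <;> omega

lemma ncard_skewPairs_in {m k : ℕ} (hk : 2 ≤ k) (hm : k / 2 + 1 ≤ m) {B : Set (Point m m)}
    (hB : B ∈ hatBlocks m k) : (pairsIn (skewPairs m) B).ncard = (k - 1) * (k - 2) := by
  rcases hB with ⟨g, rfl⟩ | ⟨g, rfl⟩ <;>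
  simp only [ncard_skewPairs_act, ncard_skewPairs_swap, ncard_skewPairs_pathPoints hk hm]

lemma ncard_of_mem_hatBlocks {m k : ℕ} (hm : k / 2 + 1 ≤ m) {B : Set (Point m m)}
    (hB : B ∈ hatBlocks m k) : B.ncard = k := by
  rcases hB with ⟨g, rfl⟩ | ⟨g, rfl⟩
  · rw [Set.ncard_image_of_injective _ (act g).injective, ncard_pathPoints hm]
  · rw [Set.ncard_image_of_injective _ (act g).injective,
      Set.ncard_image_of_injective _ Prod.swap_injective, ncard_pathPoints hm]

end GridDesign

open GridDesign in
lemma IncidenceStructure.IsDesign.ncard_blocksThrough {m v k l : ℕ}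
    {D : IncidenceStructure (Point m m)} (h : D.IsDesign 2 v k l) {x : Point m m × Point m m}
    (hx : x.1 ≠ x.2) : (blocksThrough D.blocks x).ncard = l := by
  rw [← h.card_blocks_through {x.1, x.2} (Set.ncard_pair hx)]
  congr 1
  ext B
  simp [blocksThrough, Set.insert_subset_iff]

namespace GridDesign

/-! ### The design properties -/

lemma designHat_path_blocks (m k : ℕ) : (designHat (path m k)).blocks = hatBlocks m k :=
  designHat_blocks _

lemma design_path_blocks (m k : ℕ) : (design (path m k)).blocks = orbitBlocks (pathPoints m k) :=
  design_blocks _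

lemma ncard_hatBlocks_pos (m k : ℕ) : 0 < (hatBlocks m k).ncard :=
  (Set.ncard_pos).2 ⟨_, Or.inl (self_mem_orbitBlocks _)⟩

lemma not_isTDesign_three {m k : ℕ} (h3 : 3 ≤ m) :
    ¬ (designHat (path m k)).IsTDesign 3 := by
  rintro ⟨v, k', l, h⟩
  let p : Fin 3 → Point m m := fun i => (⟨0, by omega⟩, ⟨i, by omega⟩)
  have hp : Function.Injective p := by
    intro i j hij
    simpa [p, Fin.ext_iff] using hij
  have hl := h.card_blocks_through (Set.range p)
    (by rw [← Set.image_univ, Set.ncard_image_of_injective _ hp, Set.ncard_univ, Nat.card_fin])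
  have hpos := h.l_pos
  rw [← hl, Set.ncard_pos] at hpos
  obtain ⟨B, hB, hT⟩ := hpos
  rw [designHat_path_blocks] at hB
  have hmem : ∀ i, p i ∈ B := fun i => hT ⟨i, rfl⟩
  -- No row or column contains three points of the path. The column case is needed for blocks in the
  -- orbit of the transpose.
  have key : ∀ q : Fin 3 → Point m m, Function.Injective q → (∀ i, q i ∈ pathPoints m k) →
      ((∀ i, (q i).1 = (q 0).1) ∨ ∀ i, (q i).2 = (q 0).2) → False := by
    intro q hq h1 h2
    have e01 : q 0 ≠ q 1 := fun e => by simpa using hq e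
    have e02 : q 0 ≠ q 2 := fun e => by simpa using hq e
    have e12 : q 1 ≠ q 2 := fun e => by simpa using hq e
    have a0 := h1 0
    have a1 := h1 1
    have a2 := h1 2
    have b : ((q 1).1 = (q 0).1 ∧ (q 2).1 = (q 0).1) ∨ ((q 1).2 = (q 0).2 ∧ (q 2).2 = (q 0).2) :=
      h2.imp (fun h => ⟨h 1, h 2⟩) (fun h => ⟨h 1, h 2⟩)
    simp only [mem_pathPoints, ne_eq, Prod.ext_iff, Fin.ext_iff] at *
    omega
  rcases hB with ⟨g, rfl⟩ | ⟨g, rfl⟩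
  · refine key (fun i => (act g).symm (p i)) ((act g).symm.injective.comp hp) (fun i => ?_)
      (Or.inl fun i => rfl)
    obtain ⟨q, hq, e⟩ := hmem i
    simpa [-act_apply, ← e] using hq
  · refine key (fun i => ((act g).symm (p i)).swap)
      (Prod.swap_injective.comp ((act g).symm.injective.comp hp)) (fun i => ?_)
      (Or.inr fun i => rfl)
    obtain ⟨_, ⟨q, hq, rfl⟩, e⟩ := hmem i
    simpa [-act_apply, ← e] using hq

lemma linePairs_ne {m : ℕ} {x : Point m m × Point m m} (hx : x ∈ rowPairs m ∪ colPairs m) :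
    x.1 ≠ x.2 := by
  rcases hx with ⟨-, h⟩ | ⟨h, -⟩
  · exact fun e => h (congrArg Prod.snd e)
  · exact fun e => h (congrArg Prod.fst e)

lemma skewPairs_ne {m : ℕ} {x : Point m m × Point m m} (hx : x ∈ skewPairs m) : x.1 ≠ x.2 :=
  fun e => hx.1 (congrArg Prod.fst e)

lemma eq_of_isTDesign_two {m k : ℕ} (hk : 3 ≤ k) (hm : k / 2 + 1 ≤ m)
    (h : (designHat (path m k)).IsTDesign 2) : m = k - 1 := by
  obtain ⟨v, k', l, h⟩ := h
  have hb := fun x hx => h.ncard_blocksThrough (x := x) hx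
  rw [designHat_path_blocks] at hb
  have h1 := ncard_mul_blocksThrough (fun x hx => hb x (linePairs_ne hx))
    (fun B hB => ncard_linePairs_in (by omega) hm hB)
  have h2 := ncard_mul_blocksThrough (fun x hx => hb x (skewPairs_ne hx))
    (fun B hB => ncard_skewPairs_in (by omega) hm hB)
  have hpos := ncard_hatBlocks_pos m k
  rw [ncard_linePairs] at h1
  rw [ncard_skewPairs] at h2
  generalize (hatBlocks m k).ncard = N at h1 h2 hpos
  obtain ⟨n, rfl⟩ := Nat.exists_eq_add_of_le' hk
  obtain ⟨j, rfl⟩ := Nat.exists_eq_add_of_le' (show 1 ≤ m by omega)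
  simp only [Nat.add_sub_cancel, show n + 3 - 1 = n + 2 by omega,
    show n + 3 - 2 = n + 1 by omega] at *
  -- Here `j = m - 1` and `n = k - 3`. Eliminating `l` from the two counts gives `N(k-1)(m-1) =
  -- N(k-1)(k-2)`.
  have h3 : N * (n + 2) * j = N * (n + 2) * (n + 1) := by
    calc N * (n + 2) * j = (2 * ((j + 1) * ((j + 1) * j)) * l) * j / 2 := by
          rw [h1, eq_comm]
          exact Nat.div_eq_of_eq_mul_left two_pos (by ring)
      _ = (j + 1) * j * ((j + 1) * j) * l :=
          Nat.div_eq_of_eq_mul_left two_pos (by ring)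
      _ = N * (n + 2) * (n + 1) := by rw [h2]; ring
  have h4 := Nat.eq_of_mul_eq_mul_left (by positivity) h3
  omega

lemma isDesign_two {m k : ℕ} (hk : 3 ≤ k) (hm : m = k - 1) :
    ∃ l, (designHat (path m k)).IsDesign 2 ((k - 1) ^ 2) k l ∧
      l * (m * (m - 1)) = (hatBlocks m k).ncard := by
  have hm' : k / 2 + 1 ≤ m := by omega
  obtain ⟨c, hc⟩ := exists_ncard_blocksThrough_line m k
  obtain ⟨d, hd⟩ := exists_ncard_blocksThrough_skew m k
  have h1 := ncard_mul_blocksThrough hc (fun B hB => ncard_linePairs_in (by omega) hm' hB)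
  have h2 := ncard_mul_blocksThrough hd (fun B hB => ncard_skewPairs_in (by omega) hm' hB)
  have hpos := ncard_hatBlocks_pos m k
  rw [ncard_linePairs] at h1
  rw [ncard_skewPairs] at h2
  -- With `m = k - 1`, the collinear count and the skew count reduce to the same equation, so the
  -- two constants coincide.
  have h3 : c * (m * (m - 1)) = (hatBlocks m k).ncard := by
    refine Nat.eq_of_mul_eq_mul_left (show 0 < 2 * m by omega) ?_
    rw [← hm] at h1
    linarith
  have h4 : d * (m * (m - 1)) = (hatBlocks m k).ncard := by
    refine Nat.eq_of_mul_eq_mul_left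
      (show 0 < m * (m - 1) from Nat.mul_pos (by omega) (by omega)) ?_
    rw [← hm, show k - 2 = m - 1 by omega] at h2
    linarith
  have hcd : d = c := Nat.eq_of_mul_eq_mul_right
    (show 0 < m * (m - 1) from Nat.mul_pos (by omega) (by omega)) (h4.trans h3.symm)
  refine ⟨c, ⟨by omega, pow_pos (by omega) _, by omega, ?_, ?_, ?_, ?_⟩, h3⟩
  · rcases Nat.eq_zero_or_pos c with rfl | h
    · omega
    · exact h
  · rw [Nat.card_prod, Nat.card_fin, hm, sq]
  · rw [designHat_path_blocks]
    exact fun B hB => ncard_of_mem_hatBlocks hm' hB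
  · intro T hT
    obtain ⟨p, q, hpq, rfl⟩ := Set.ncard_eq_two.1 hT
    have : {B | B ∈ (designHat (path m k)).blocks ∧ {p, q} ⊆ B} =
        blocksThrough (hatBlocks m k) (p, q) := by
      ext B
      simp [blocksThrough, Set.insert_subset_iff, designHat_path_blocks]
    rw [this]
    by_cases e1 : p.1 = q.1
    · exact hc (p, q) (Or.inl ⟨e1, fun e2 => hpq (Prod.ext e1 e2)⟩)
    · by_cases e2 : p.2 = q.2
      · exact hc (p, q) (Or.inr ⟨e1, e2⟩)
      · rw [← hcd]
        exact hd (p, q) ⟨e1, e2⟩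

/-- Substitute `b = l·m(m-1)` into the block count and cancel `m(m-1)` from one factor `m! =
m(m-1)(m-2)!`, with `m = k - 1`. -/
lemma mul_factorial_eq {m k l : ℕ} (hk : 3 ≤ k) (hm : m = k - 1)
    (hl : l * (m * (m - 1)) = (hatBlocks m k).ncard) :
    l * ((m - (k / 2 + 1)).factorial * (m - (k + 1) / 2).factorial) =
      (k - 1).factorial * (k - 3).factorial := by
  have h := ncard_hatBlocks (m := m) (k := k) (by omega) (by omega)
  rw [← hl] at h
  obtain ⟨n, rfl⟩ := Nat.exists_eq_add_of_le' hk
  obtain rfl : m = n + 2 := hm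
  have hf : (n + 2).factorial = ((n + 2) * (n + 1)) * n.factorial := by
    rw [Nat.factorial_succ, Nat.factorial_succ, mul_assoc]
  refine Nat.eq_of_mul_eq_mul_left (show 0 < (n + 2) * (n + 1) by positivity) ?_
  simp only [Nat.add_sub_cancel, show n + 3 - 1 = n + 2 by omega,
    show n + 2 - 1 = n + 1 by omega] at *
  calc _ = (n + 2).factorial * (n + 2).factorial := by rw [← h]; ring
    _ = (n + 2).factorial * (((n + 2) * (n + 1)) * n.factorial) := by rw [← hf]
    _ = _ := by ring

/-- The grid has as many row pairs as column pairs, so a constant `λ` would force equally many of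
each in a block; for even `k` the path has `k - 2` and `k`. -/
lemma not_isTDesign_design {m k : ℕ} (hk : 3 ≤ k) (he : Even k) (hm : k / 2 + 1 ≤ m) :
    ¬ (design (path m k)).IsTDesign 2 := by
  rintro ⟨v, k', l, h⟩
  have hb := fun x hx => h.ncard_blocksThrough (x := x) hx
  rw [design_path_blocks] at hb
  have h1 := ncard_mul_blocksThrough (X := rowPairs m) (d := 2 * ((k + 1) / 2 - 1))
    (fun x hx => hb x (linePairs_ne (Or.inl hx)))
    (by rintro _ ⟨g, rfl⟩; simp only [ncard_rowPairs_act, ncard_rowPairs_pathPoints hm])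
  have h2 := ncard_mul_blocksThrough (X := colPairs m) (d := 2 * (k / 2))
    (fun x hx => hb x (linePairs_ne (Or.inr hx)))
    (by rintro _ ⟨g, rfl⟩; simp only [ncard_colPairs_act, ncard_colPairs_pathPoints hm])
  rw [ncard_colPairs, ← ncard_rowPairs, h1] at h2
  have := Nat.eq_of_mul_eq_mul_left ((Set.ncard_pos).2 ⟨_, self_mem_orbitBlocks _⟩) h2
  obtain ⟨j, rfl⟩ := he
  omega

lemma designHat_eq_design {m k : ℕ} (ho : Odd k) (hm : k / 2 + 1 ≤ m) :
    designHat (path m k) = design (path m k) := by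
  ext1
  rw [designHat_path_blocks, design_path_blocks, hatBlocks_odd ho hm]

end GridDesign

theorem lemma4p2 (m k : ℕ) (hk : 3 ≤ k) (hm : k / 2 + 1 ≤ m) :
    (¬ (k = 3 ∧ m = 2) →
      ¬ (GridDesign.designHat (GridDesign.path m k)).IsTDesign 3) ∧
    ((GridDesign.designHat (GridDesign.path m k)).IsTDesign 2 ↔ m = k - 1) ∧
    (m = k - 1 →
      (Odd k →
        (GridDesign.designHat (GridDesign.path m k) = GridDesign.design (GridDesign.path m k) ∧
          (GridDesign.design (GridDesign.path m k)).IsTDesign 2) ∧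
        ∃ l : ℕ, (l : ℚ) = ((k - 1).factorial * (k - 3).factorial : ℚ) /
            (((k - 3) / 2).factorial : ℚ) ^ 2 ∧
          (GridDesign.designHat (GridDesign.path m k)).IsDesign 2 ((k - 1) ^ 2) k l) ∧
      (Even k →
        (GridDesign.designHat (GridDesign.path m k) ≠ GridDesign.design (GridDesign.path m k) ∧
          ¬ (GridDesign.design (GridDesign.path m k)).IsTDesign 2) ∧
        ∃ l : ℕ, (l : ℚ) = ((k - 1).factorial * (k - 3).factorial : ℚ) /
            (((k / 2 - 2).factorial * (k / 2 - 1).factorial : ℕ) : ℚ) ∧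
          (GridDesign.designHat (GridDesign.path m k)).IsDesign 2 ((k - 1) ^ 2) k l)) := by
  open GridDesign in
  -- The bound on `m` gives `m ≥ 2`, and `m = 2` forces `k = 3`; outside that case `m ≥ 3`.
  refine ⟨fun h => not_isTDesign_three (by omega), ⟨eq_of_isTDesign_two hk hm, fun h => ?_⟩,
    fun h => ?_⟩
  · obtain ⟨l, hl, -⟩ := isDesign_two hk h
    exact ⟨_, _, l, hl⟩
  · obtain ⟨l, hl, hl'⟩ := isDesign_two hk h
    have hf := mul_factorial_eq hk h hl'
    refine ⟨fun ho => ⟨⟨designHat_eq_design ho hm, ?_⟩, l, ?_, hl⟩,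
      fun he => ⟨⟨fun e => ?_, not_isTDesign_design hk he hm⟩, l, ?_, hl⟩⟩
    · rw [← designHat_eq_design ho hm]
      exact ⟨_, _, l, hl⟩
    · have e1 : m - (k / 2 + 1) = (k - 3) / 2 := by obtain ⟨j, rfl⟩ := ho; omega
      have e2 : m - (k + 1) / 2 = (k - 3) / 2 := by obtain ⟨j, rfl⟩ := ho; omega
      rw [e1, e2] at hf
      rw [eq_div_iff (by positivity), sq]
      exact_mod_cast hf
    · exact not_isTDesign_design hk he hm (e ▸ ⟨_, _, l, hl⟩)
    · have e1 : m - (k / 2 + 1) = k / 2 - 2 := by obtain ⟨j, rfl⟩ := he; omega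
      have e2 : m - (k + 1) / 2 = k / 2 - 1 := by obtain ⟨j, rfl⟩ := he; omega
      rw [e1, e2] at hf
      rw [eq_div_iff (by positivity)]
      exact_mod_cast hf
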